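/- For integers $u,v\ge 2$ and $n\ge 0$ let $B_{u,v}(n)$ denote the number of $(u,v)$-regular bipartitions of $n$, i.e. of pairs $(\alpha,\beta)$ of (possibly empty) partitions such that the sum of all parts of $\alpha$ and $\beta$ is $n$, no part of $\alpha$ is divisible by $u$, and no part of $\beta$ is divisible by $v$ (so $B_{u,v}(0)=1$). Let $k$ and $n$ be non-negative integers, let $p$ be a prime number, and let $j$ be an integer with $p\nmid j$. Then the following hold whenever the argument of $B$ is non-negative (in particular whenever $j\ge 0$). (i) If $p\equiv 2\pmod 3$ (the case $p=2$ being allowed), then $$B_{3,7}\left(p^{2k+2}n+p^{2k+1}j+\frac{p^{2k+2}-1}{3}\right)\equiv 0\pmod 3.$$ (ii) If $p\equiv 3\pmod 4$, then $$B_{3,5}\left(p^{2k+2}n+p^{2k+1}j+\frac{p^{2k+2}-1}{4}\right)\equiv 0\pmod 3.$$ (iii) If $p$ is odd and $p\not\equiv 1\pmod 8$, then $$B_{3,2}\left(p^{2k+2}n+p^{2k+1}j+\frac{p^{2k+2}-1}{8}\right)\equiv 0\pmod 3.$$ -/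

import Mathlib

/-- The finite set of `(u, v)`-regular bipartitions of `n`: the pairs `(α, β)` of partitions, of
`a.1` and `a.2` with `a.1 + a.2 = n`, such that no part of `α` is divisible by `u` and no part of
`β` is divisible by `v`. -/
def regularBipartitions (u v n : ℕ) : Finset (Σ a : ℕ × ℕ, a.1.Partition × a.2.Partition) :=
  (Finset.HasAntidiagonal.antidiagonal n).sigma fun a =>
    Nat.Partition.restricted a.1 (fun i => ¬ u ∣ i) ×ˢ
      Nat.Partition.restricted a.2 (fun i => ¬ v ∣ i)

/-- `B_{u,v}(n)`: the number of `(u, v)`-regular bipartitions of `n`. -/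
def numRegularBipartitions (u v n : ℕ) : ℕ :=
  (regularBipartitions u v n).card

/-!
Write `f_m = ∏ (1 - q ^ (m i))`. The generating function of `B_{u,v}` is `f_u f_v / f_1 ^ 2`, and
`f_3 = f_1 ^ 3` modulo 3, so that the generating function of `B_{3,v}` is `f_1 f_v` modulo 3
(`truncate_regularSeries_three_mul`). In each case `f_1 f_v` is a product of two theta series by the
Jacobi triple product (`tripleProduct`), whose coefficients count representations by a binary
quadratic form with signs (`numRegularBipartitions_eq_sum`). The arguments of `B` in the theorem are
those `m` for which `c * m + 1`, with `c = 3`, `4`, `8` respectively, has odd `p`-adic valuation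
(`exists_mul_add_one_eq`).

For `v = 5` and `v = 2` the theta series can be chosen such that the form is `x ^ 2 + y ^ 2` or
`x ^ 2 + 2 * y ^ 2` and `p` is inert for it. Then an integer of odd `p`-adic valuation has no
representation at all (`ne_of_odd_valuation`).

For `v = 7` the form is `x ^ 2 + 7 * y ^ 2`, and a prime `p ≡ 2 [MOD 3]` may split. Modulo 3 the sign
of a representation by pairs of pentagonal numbers is a quadratic polynomial: up to a factor, the
coefficient is the sum of `x * y` over the odd solutions `x ≡ y [ZMOD 4]` of
`x ^ 2 + 7 * y ^ 2 = 8 * M` with `M = 3 * m + 1` (`sum_thetaPairs_eq`). Multiplication by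
`(1 + √-7) / 2` removes the powers of 2 from `M`: the sum vanishes if the 2-adic valuation of `M` is
odd, which settles `p = 2`, and is otherwise, up to sign, the sum of `a ^ 2 - b ^ 2` over all
solutions of `a ^ 2 + 7 * b ^ 2 = M'`, the odd part of `M` (`sum_mul_oddReps_eq_zero`). This last
sum is a theta series with a Hecke relation: if `p = u ^ 2 + 7 * v ^ 2`, the multiples of
`u ± v * √-7` contribute zero modulo 3, as the summand becomes a multiple of `c * d` and `d ↦ -d` is
a symmetry. By inclusion and exclusion the coefficient at `p ^ 2 * n` is minus that at `n`, and it
vanishes at `p * n` for `p` not dividing `n` (`normSevenTheta_mul_prime`). That a split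
`p ≡ 2 [MOD 3]` has the form `u ^ 2 + 7 * v ^ 2` follows from Thue's lemma.
-/

/-! ### The Jacobi triple product -/

section TripleProduct

variable {R : Type*} [CommRing R]

/-- The Gaussian binomial coefficient `[s + t, s]_q`, defined by the `q`-Pascal rule. -/
def gaussBinom (q : R) : ℕ → ℕ → R
  | 0, _ => 1
  | _ + 1, 0 => 1
  | s + 1, t + 1 => gaussBinom q s (t + 1) + q ^ (s + 1) * gaussBinom q (s + 1) t

@[simp] lemma gaussBinom_zero_left (q : R) (t : ℕ) : gaussBinom q 0 t = 1 := by
  simp [gaussBinom]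

@[simp] lemma gaussBinom_zero_right (q : R) (s : ℕ) : gaussBinom q s 0 = 1 := by
  cases s <;> simp [gaussBinom]

lemma gaussBinom_succ_succ (q : R) (s t : ℕ) :
    gaussBinom q (s + 1) (t + 1) =
      gaussBinom q s (t + 1) + q ^ (s + 1) * gaussBinom q (s + 1) t := by
  rw [gaussBinom]

lemma one_sub_pow_mul_gaussBinom (q : R) (s t : ℕ) :
    (1 - q ^ (t + 1)) * gaussBinom q s (t + 1) = (1 - q ^ (s + 1)) * gaussBinom q (s + 1) t := by
  match s, t with
  | 0, 0 => simp
  | 0, t + 1 =>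
    have h := one_sub_pow_mul_gaussBinom q 0 t
    rw [gaussBinom_succ_succ]
    simp only [gaussBinom_zero_left, zero_add, pow_one] at h ⊢
    linear_combination q * h
  | s + 1, 0 =>
    have h := one_sub_pow_mul_gaussBinom q s 0
    rw [gaussBinom_succ_succ]
    simp only [gaussBinom_zero_right, zero_add, pow_one] at h ⊢
    linear_combination h
  | s + 1, t + 1 =>
    have h := one_sub_pow_mul_gaussBinom q s (t + 1)
    have h' := one_sub_pow_mul_gaussBinom q (s + 1) t
    rw [gaussBinom_succ_succ, gaussBinom_succ_succ q (s + 1) t]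
    linear_combination h + q ^ (s + 1 + 1) * h'
  termination_by s + t

/-- The second `q`-Pascal rule. -/
lemma gaussBinom_succ_succ' (q : R) (s t : ℕ) :
    gaussBinom q (s + 1) (t + 1) =
      q ^ (t + 1) * gaussBinom q s (t + 1) + gaussBinom q (s + 1) t := by
  linear_combination gaussBinom_succ_succ q s t + one_sub_pow_mul_gaussBinom q s t

/-- The finite `q`-Pochhammer product `(1 - q) (1 - q ^ 2) ⋯ (1 - q ^ n)`. -/
def qFactorial (q : R) (n : ℕ) : R := ∏ i ∈ Finset.range n, (1 - q ^ (i + 1))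

lemma qFactorial_succ (q : R) (n : ℕ) :
    qFactorial q (n + 1) = qFactorial q n * (1 - q ^ (n + 1)) := by
  simp [qFactorial, Finset.prod_range_succ]

lemma gaussBinom_mul_qFactorial (q : R) (s t : ℕ) :
    gaussBinom q s t * (qFactorial q s * qFactorial q t) = qFactorial q (s + t) := by
  match s, t with
  | 0, t => simp [qFactorial]
  | s + 1, 0 => simp [qFactorial]
  | s + 1, t + 1 =>
    have h := gaussBinom_mul_qFactorial q s (t + 1)
    have h' := gaussBinom_mul_qFactorial q (s + 1) t
    rw [show s + (t + 1) = s + t + 1 by ring] at h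
    rw [show s + 1 + t = s + t + 1 by ring] at h'
    rw [show s + 1 + (t + 1) = s + t + 1 + 1 by ring, qFactorial_succ q (s + t + 1),
      gaussBinom_succ_succ]
    rw [qFactorial_succ q t] at h ⊢
    rw [qFactorial_succ q s] at h' ⊢
    linear_combination (1 - q ^ (s + 1)) * h + q ^ (s + 1) * (1 - q ^ (t + 1)) * h'
  termination_by s + t

lemma sum_mul_gaussBinom_succ (q : R) (F : ℕ → R) (n : ℕ) :
    ∑ st ∈ Finset.HasAntidiagonal.antidiagonal (n + 1), F st.1 * gaussBinom q st.1 st.2 =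
      ∑ st ∈ Finset.HasAntidiagonal.antidiagonal n,
        (F (st.1 + 1) + F st.1 * q ^ st.1) * gaussBinom q st.1 st.2 := by
  let u : ℕ → ℕ → R := fun s t => match s with
    | 0 => 0
    | s + 1 => gaussBinom q s t
  let v : ℕ → ℕ → R := fun s t => match t with
    | 0 => 0
    | t + 1 => gaussBinom q s t
  have h : ∀ st ∈ Finset.HasAntidiagonal.antidiagonal (n + 1), F st.1 * gaussBinom q st.1 st.2 =
      F st.1 * u st.1 st.2 + F st.1 * q ^ st.1 * v st.1 st.2 := by
    rintro ⟨s, t⟩ hst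
    match s, t with
    | 0, 0 => simp at hst
    | 0, t + 1 => simp [u, v]
    | s + 1, 0 => simp [u, v]
    | s + 1, t + 1 => simp only [u, v, gaussBinom_succ_succ]; ring
  rw [Finset.sum_congr rfl h, Finset.sum_add_distrib, Finset.Nat.sum_antidiagonal_succ,
    Finset.Nat.sum_antidiagonal_succ' (f := fun st => F st.1 * q ^ st.1 * v st.1 st.2)]
  simp [u, v, add_mul, Finset.sum_add_distrib]

lemma sum_mul_gaussBinom_succ' (q : R) (F : ℕ → R) (n : ℕ) :
    ∑ st ∈ Finset.HasAntidiagonal.antidiagonal (n + 1), F st.1 * gaussBinom q st.1 st.2 =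
      ∑ st ∈ Finset.HasAntidiagonal.antidiagonal n,
        (F (st.1 + 1) * q ^ st.2 + F st.1) * gaussBinom q st.1 st.2 := by
  let u : ℕ → ℕ → R := fun s t => match s with
    | 0 => 0
    | s + 1 => gaussBinom q s t
  let v : ℕ → ℕ → R := fun s t => match t with
    | 0 => 0
    | t + 1 => gaussBinom q s t
  have h : ∀ st ∈ Finset.HasAntidiagonal.antidiagonal (n + 1), F st.1 * gaussBinom q st.1 st.2 =
      F st.1 * q ^ st.2 * u st.1 st.2 + F st.1 * v st.1 st.2 := by
    rintro ⟨s, t⟩ hst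
    match s, t with
    | 0, 0 => simp at hst
    | 0, t + 1 => simp [u, v]
    | s + 1, 0 => simp [u, v]
    | s + 1, t + 1 => simp only [u, v, gaussBinom_succ_succ']; ring
  rw [Finset.sum_congr rfl h, Finset.sum_add_distrib, Finset.Nat.sum_antidiagonal_succ,
    Finset.Nat.sum_antidiagonal_succ' (f := fun st => F st.1 * v st.1 st.2)]
  simp [u, v, add_mul, Finset.sum_add_distrib]

/-- The finite Jacobi triple product. The hypotheses on `T` say that
`T k = A ^ (k (k + 1) / 2) * B ^ (k (k - 1) / 2)` and `q = A * B`, without dividing by `q`. -/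
theorem finite_tripleProduct (q A B : R) (T : ℤ → R) (h0 : T 0 = 1)
    (hA : ∀ (k : ℤ) (m s : ℕ), (s : ℤ) = m - k → A * q ^ m * T k = T (k + 1) * q ^ s)
    (hB : ∀ (k : ℤ) (l s : ℕ), (s : ℤ) = l + k → B * q ^ l * T k = T (k - 1) * q ^ s)
    (m l : ℕ) :
    (∏ i ∈ Finset.range m, (1 + A * q ^ i)) * ∏ i ∈ Finset.range l, (1 + B * q ^ i) =
      ∑ st ∈ Finset.HasAntidiagonal.antidiagonal (m + l), T (st.1 - l) * gaussBinom q st.1 st.2 := by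
  induction m with
  | zero =>
    induction l with
    | zero => simp [h0]
    | succ l ih =>
      rw [Finset.prod_range_succ, ← mul_assoc, ih, Finset.sum_mul, ← add_assoc,
        sum_mul_gaussBinom_succ q (fun s : ℕ => T (s - ((l + 1 : ℕ) : ℤ)))]
      refine Finset.sum_congr rfl fun st hst => ?_
      have := hB (st.1 - l) l st.1 (by ring)
      have e1 : ((st.1 + 1 : ℕ) : ℤ) - ((l + 1 : ℕ) : ℤ) = st.1 - l := by push_cast; ring
      have e2 : (st.1 : ℤ) - ((l + 1 : ℕ) : ℤ) = st.1 - l - 1 := by push_cast; ring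
      simp only [e1, e2]
      linear_combination gaussBinom q st.1 st.2 * this
  | succ m ih =>
    rw [Finset.prod_range_succ, mul_right_comm, ih, Finset.sum_mul,
      show m + 1 + l = m + l + 1 by ring,
      sum_mul_gaussBinom_succ' q (fun s : ℕ => T (s - (l : ℤ)))]
    refine Finset.sum_congr rfl fun st hst => ?_
    have hst : st.1 + st.2 = m + l := by simpa using hst
    have := hA (st.1 - l) m st.2 (by omega)
    have e1 : ((st.1 + 1 : ℕ) : ℤ) - l = st.1 - l + 1 := by push_cast; ring
    simp only [e1]
    linear_combination gaussBinom q st.1 st.2 * this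

/-- The exponent `a * k (k + 1) / 2 + b * k (k - 1) / 2` of a theta series. Both fractions are
nonnegative integers. -/
def thetaExp (a b : ℕ) (k : ℤ) : ℕ := a * (k * (k + 1) / 2).toNat + b * (k * (k - 1) / 2).toNat

lemma two_mul_thetaExp (a b : ℕ) (k : ℤ) :
    2 * (thetaExp a b k : ℤ) = a * (k * (k + 1)) + b * (k * (k - 1)) := by
  have h1 : 0 ≤ k * (k + 1) := by
    rcases le_or_gt 0 k with h | h
    · positivity
    · exact mul_nonneg_of_nonpos_of_nonpos h.le (by omega)
  have h2 : 0 ≤ k * (k - 1) := by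
    rcases le_or_gt k 0 with h | h
    · exact mul_nonneg_of_nonpos_of_nonpos h (by omega)
    · exact mul_nonneg h.le (by omega)
  have e1 : 2 * (k * (k + 1) / 2) = k * (k + 1) :=
    Int.mul_ediv_cancel' (Int.even_mul_succ_self k).two_dvd
  have e2 : 2 * (k * (k - 1) / 2) = k * (k - 1) :=
    Int.mul_ediv_cancel' (Int.even_mul_pred_self k).two_dvd
  simp only [thetaExp, Nat.cast_add, Nat.cast_mul]
  rw [Int.toNat_of_nonneg (by omega), Int.toNat_of_nonneg (by omega)]
  linear_combination (a : ℤ) * e1 + (b : ℤ) * e2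

lemma natAbs_le_thetaExp {a b : ℕ} (ha : 1 ≤ a) (hb : 1 ≤ b) (k : ℤ) :
    k.natAbs ≤ thetaExp a b k := by
  have h := two_mul_thetaExp a b k
  have h' := two_mul_thetaExp 1 1 k
  have hle : thetaExp 1 1 k ≤ thetaExp a b k := by
    unfold thetaExp; gcongr
  have : (k.natAbs : ℤ) ≤ k ^ 2 := by
    rw [← Int.natAbs_sq]
    exact_mod_cast Nat.le_self_pow two_ne_zero _
  push_cast at h'
  zify at hle ⊢
  simp only [Int.natCast_natAbs] at this
  nlinarith

/-- The partial sum over `|k| ≤ N` of the theta series `∑ₖ (-1) ^ k x ^ thetaExp a b k`. -/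
noncomputable def thetaSum (a b N : ℕ) (x : R) : R :=
  ∑ k ∈ Finset.Icc (-(N : ℤ)) N, (-1) ^ k.natAbs * x ^ thetaExp a b k

lemma neg_one_pow_natAbs_add_one (k : ℤ) :
    (-1 : R) ^ (k + 1).natAbs = -(-1) ^ k.natAbs := by
  rcases Int.even_or_odd k with h | h
  · rw [(Int.natAbs_odd.2 h.add_one).neg_one_pow, (Int.natAbs_even.2 h).neg_one_pow]
  · rw [(Int.natAbs_even.2 h.add_one).neg_one_pow, (Int.natAbs_odd.2 h).neg_one_pow]; simp

lemma qFactorial_eq_of_pow_eq_zero {q : R} {N : ℕ} (hq : q ^ N = 0) {n : ℕ} (hn : N ≤ n) :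
    qFactorial q n = qFactorial q N := by
  refine (Finset.prod_subset (Finset.range_subset_range.2 hn) fun i _ hi => ?_).symm
  rw [pow_eq_zero_of_le (by simp at hi; omega) hq, sub_zero]

lemma isUnit_qFactorial {q : R} {N : ℕ} (hq : q ^ N = 0) (n : ℕ) : IsUnit (qFactorial q n) := by
  refine Finset.prod_induction _ IsUnit (fun _ _ => IsUnit.mul) isUnit_one fun i _ => ?_
  exact IsNilpotent.isUnit_one_sub ⟨N, by rw [← pow_mul, mul_comm, pow_mul, hq, zero_pow (by omega)]⟩

/-- The Jacobi triple product for `A = -x ^ a`, `B = -x ^ b`, modulo `x ^ N`. The statement holds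
in any ring in which `x ^ N = 0`, so that it can be used in quotients of power series rings. -/
theorem tripleProduct {a b N : ℕ} (ha : 1 ≤ a) (hb : 1 ≤ b) {x : R} (hx : x ^ N = 0) :
    (∏ i ∈ Finset.range N, (1 - x ^ (a + (a + b) * i))) *
      (∏ i ∈ Finset.range N, (1 - x ^ (b + (a + b) * i))) *
      (∏ i ∈ Finset.range N, (1 - x ^ ((a + b) * (i + 1)))) = thetaSum a b N x := by
  set q : R := x ^ (a + b) with hq
  have hqN : q ^ N = 0 := by
    rw [hq, ← pow_mul, mul_comm, pow_mul, hx, zero_pow (by omega)]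
  let T : ℤ → R := fun k => (-1) ^ k.natAbs * x ^ thetaExp a b k
  have hT : ∀ k : ℤ, N ≤ k.natAbs → T k = 0 := fun k hk => by
    simp only [T]
    rw [pow_eq_zero_of_le (hk.trans (natAbs_le_thetaExp ha hb k)) hx, mul_zero]
  have key := finite_tripleProduct q (-x ^ a) (-x ^ b) T (by simp [T, thetaExp])
    (fun k m s hs => by
      have e : a + (a + b) * m + thetaExp a b k = thetaExp a b (k + 1) + (a + b) * s := by
        have h1 := two_mul_thetaExp a b k
        have h2 := two_mul_thetaExp a b (k + 1)
        zify
        rw [hs]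
        linarith
      have : x ^ a * q ^ m * x ^ thetaExp a b k = x ^ thetaExp a b (k + 1) * q ^ s := by
        rw [hq, ← pow_mul, ← pow_mul, ← pow_add, ← pow_add, ← pow_add, e]
      simp only [T, neg_one_pow_natAbs_add_one]
      linear_combination -(-1) ^ k.natAbs * this)
    (fun k l s hs => by
      have e : b + (a + b) * l + thetaExp a b k = thetaExp a b (k - 1) + (a + b) * s := by
        have h1 := two_mul_thetaExp a b k
        have h2 := two_mul_thetaExp a b (k - 1)
        zify
        rw [hs]
        linarith
      have : x ^ b * q ^ l * x ^ thetaExp a b k = x ^ thetaExp a b (k - 1) * q ^ s := by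
        rw [hq, ← pow_mul, ← pow_mul, ← pow_add, ← pow_add, ← pow_add, e]
      have hs' := neg_one_pow_natAbs_add_one (R := R) (k - 1)
      rw [sub_add_cancel] at hs'
      simp only [T, hs']
      linear_combination (-1) ^ (k - 1).natAbs * this) (2 * N) (2 * N)
  have trunc : ∀ c : ℕ, 1 ≤ c → ∏ i ∈ Finset.range (2 * N), (1 + -x ^ c * q ^ i) =
      ∏ i ∈ Finset.range N, (1 - x ^ (c + (a + b) * i)) := fun c hc => by
    symm
    rw [← Finset.prod_subset (Finset.range_subset_range.2 (show N ≤ 2 * N by omega))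
      fun i _ hi => ?_]
    · refine Finset.prod_congr rfl fun i _ => ?_
      rw [hq, ← pow_mul, pow_add]; ring
    · rw [pow_eq_zero_of_le (by simpa using hi) hqN]; ring
  rw [trunc a ha, trunc b hb] at key
  have hfac : ∏ i ∈ Finset.range N, (1 - x ^ ((a + b) * (i + 1))) = qFactorial q N := by
    simp [qFactorial, hq, pow_mul]
  have hbinom : ∀ s t : ℕ, N ≤ s → N ≤ t → gaussBinom q s t * qFactorial q N = 1 := by
    intro s t hs ht
    have h := gaussBinom_mul_qFactorial q s t
    rw [qFactorial_eq_of_pow_eq_zero hqN hs, qFactorial_eq_of_pow_eq_zero hqN ht,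
      qFactorial_eq_of_pow_eq_zero hqN (by omega : N ≤ s + t), ← mul_assoc] at h
    exact (isUnit_qFactorial hqN N).mul_right_cancel (by rw [h, one_mul])
  rw [key, hfac, Finset.sum_mul]
  -- Terms with `|k| ≥ N` vanish; the others carry the coefficient `1`.
  have hterm : ∀ st ∈ Finset.HasAntidiagonal.antidiagonal (2 * N + 2 * N),
      T (st.1 - ((2 * N : ℕ) : ℤ)) * gaussBinom q st.1 st.2 * qFactorial q N =
        T (st.1 - ((2 * N : ℕ) : ℤ)) := by
    intro st hst
    have hst : st.1 + st.2 = 2 * N + 2 * N := by simpa using hst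
    by_cases h : N ≤ st.1 ∧ N ≤ st.2
    · rw [mul_assoc, hbinom _ _ h.1 h.2, mul_one]
    · rw [hT _ (by omega)]; simp
  rw [Finset.sum_congr rfl hterm, thetaSum, Finset.Nat.sum_antidiagonal_eq_sum_range_succ_mk]
  change ∑ s ∈ Finset.range (2 * N + 2 * N + 1), T (s - ((2 * N : ℕ) : ℤ)) =
    ∑ k ∈ Finset.Icc (-(N : ℤ)) N, T k
  symm
  refine Finset.sum_of_injOn (fun k : ℤ => (k + 2 * N).toNat) ?_ ?_ ?_ ?_
  · intro k hk l hl h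
    simp only [Finset.coe_Icc, Set.mem_Icc] at hk hl h
    omega
  · intro k hk
    simp only [Finset.coe_Icc, Set.mem_Icc, Finset.coe_range, Set.mem_Iio] at hk ⊢
    omega
  · intro s _ hs
    refine hT _ ?_
    by_contra! hlt
    refine hs ⟨(s : ℤ) - 2 * N, ?_, ?_⟩
    · simp only [Finset.coe_Icc, Set.mem_Icc]; omega
    · simp
  · intro k hk
    simp only [Finset.mem_Icc] at hk
    congr 1
    omega

end TripleProduct

/-! ### Generating functions modulo 3 -/

section GeneratingFunction

open PowerSeries

/-- The generating function of the partitions without parts divisible by `m`, over `ZMod 3`. -/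
noncomputable def regularSeries (m : ℕ) : (ZMod 3)⟦X⟧ :=
  PowerSeries.mk fun n => ((Nat.Partition.restricted n (fun i => ¬ m ∣ i)).card : ZMod 3)

lemma coeff_regularSeries_mul (u v n : ℕ) :
    coeff n (regularSeries u * regularSeries v) = (numRegularBipartitions u v n : ZMod 3) := by
  simp [coeff_mul, regularSeries, numRegularBipartitions, regularBipartitions,
    Finset.card_sigma, Finset.card_product]

/-- The ring of power series over `ZMod 3` modulo `X ^ N`. -/
abbrev TruncatedSeries (N : ℕ) : Type := (ZMod 3)⟦X⟧ ⧸ Ideal.span {(X : (ZMod 3)⟦X⟧) ^ N}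

/-- The projection from power series to power series modulo `X ^ N`. -/
noncomputable abbrev truncate (N : ℕ) : (ZMod 3)⟦X⟧ →+* TruncatedSeries N :=
  Ideal.Quotient.mk (Ideal.span {(X : (ZMod 3)⟦X⟧) ^ N})

lemma truncate_eq_iff {N : ℕ} {f g : (ZMod 3)⟦X⟧} :
    truncate N f = truncate N g ↔ ∀ d < N, coeff d f = coeff d g := by
  rw [Ideal.Quotient.eq, Ideal.mem_span_singleton, X_pow_dvd_iff]
  simp [sub_eq_zero]

lemma truncate_X_pow (N : ℕ) : truncate N X ^ N = 0 := by
  rw [← map_pow, Ideal.Quotient.eq_zero_iff_mem]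
  exact Ideal.mem_span_singleton_self _

open scoped PowerSeries.WithPiTopology in
lemma truncate_regularSeries_mul {m : ℕ} (hm : 0 < m) (N : ℕ) :
    truncate N (regularSeries m) * qFactorial (truncate N X) N =
      qFactorial (truncate N X ^ m) N := by
  have hprod := Nat.Partition.hasProd_powerSeriesMk_card_countRestricted (ZMod 3) hm
  rw [← Nat.Partition.powerSeriesMk_card_restricted_eq_powerSeriesMk_card_countRestricted _ hm]
    at hprod
  have hlim := (WithPiTopology.tendsto_iff_coeff_tendsto _ _ _ _).1 hprod.tendsto_prod_nat
  have hev : ∀ᶠ L in Filter.atTop, ∀ d ∈ Finset.range N,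
      coeff d (∏ i ∈ Finset.range L, ∑ j ∈ Finset.range m, (X : (ZMod 3)⟦X⟧) ^ ((i + 1) * j)) =
        coeff d (regularSeries m) := by
    rw [Filter.eventually_all_finset]
    intro d _
    have := hlim d
    rw [nhds_discrete, Filter.tendsto_pure] at this
    exact this
  obtain ⟨L, hL, hNL⟩ := (hev.and (Filter.eventually_ge_atTop N)).exists
  have htr : truncate N (regularSeries m) = truncate N
      (∏ i ∈ Finset.range L, ∑ j ∈ Finset.range m, (X : (ZMod 3)⟦X⟧) ^ ((i + 1) * j)) :=
    truncate_eq_iff.2 fun d hd => (hL d (Finset.mem_range.2 hd)).symm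
  have hx := truncate_X_pow N
  have hxm : (truncate N X ^ m) ^ N = 0 := by
    rw [← pow_mul, mul_comm, pow_mul, hx, zero_pow hm.ne']
  rw [htr, ← qFactorial_eq_of_pow_eq_zero hx hNL, ← qFactorial_eq_of_pow_eq_zero hxm hNL,
    map_prod, qFactorial, qFactorial, ← Finset.prod_mul_distrib]
  refine Finset.prod_congr rfl fun i _ => ?_
  simp only [map_sum, map_pow, pow_mul]
  rw [geom_sum_mul_neg, ← pow_mul, ← pow_mul, mul_comm]

lemma qFactorial_pow_three {R : Type*} [CommRing R] (h3 : (3 : R) = 0) (q : R) (n : ℕ) :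
    qFactorial (q ^ 3) n = qFactorial q n ^ 3 := by
  rw [qFactorial, qFactorial, ← Finset.prod_pow]
  refine Finset.prod_congr rfl fun i _ => ?_
  rw [← pow_mul, mul_comm, pow_mul]
  linear_combination (q ^ (i + 1) - (q ^ (i + 1)) ^ 2) * h3

lemma three_eq_zero_truncatedSeries (N : ℕ) : (3 : TruncatedSeries N) = 0 := by
  have h : (3 : (ZMod 3)⟦X⟧) = 0 := by
    rw [← map_ofNat (C (R := ZMod 3)) 3, show (OfNat.ofNat 3 : ZMod 3) = 0 from rfl, map_zero]
  rw [← map_ofNat (truncate N) 3, h, map_zero]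

/-- Modulo 3, the generating function of `B_{3,v}` is `∏ (1 - q ^ i) (1 - q ^ (v i))`. -/
lemma truncate_regularSeries_three_mul {v : ℕ} (hv : 0 < v) (N : ℕ) :
    truncate N (regularSeries 3 * regularSeries v) =
      qFactorial (truncate N X) N * qFactorial (truncate N X ^ v) N := by
  have h3 := truncate_regularSeries_mul (m := 3) (by norm_num) N
  have hv := truncate_regularSeries_mul hv N
  rw [qFactorial_pow_three (three_eq_zero_truncatedSeries N)] at h3
  have hu := isUnit_qFactorial (truncate_X_pow N) N
  refine (hu.pow 2).mul_right_cancel ?_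
  rw [map_mul]
  linear_combination qFactorial (truncate N X) N * truncate N (regularSeries v) * h3 +
    qFactorial (truncate N X) N ^ 3 * hv

/-- The pairs `(k, l)` at which the product of two theta series has exponent `d`. The box is large
enough to contain all of them. -/
noncomputable def thetaPairs (a b a' b' d : ℕ) : Finset (ℤ × ℤ) :=
  (Finset.Icc (-((d + 1 : ℕ) : ℤ)) (d + 1 : ℕ) ×ˢ Finset.Icc (-((d + 1 : ℕ) : ℤ)) (d + 1 : ℕ)).filter
    fun kl => thetaExp a b kl.1 + thetaExp a' b' kl.2 = d

/-- If `∏ (1 - q ^ i) (1 - q ^ (v i))` is a product of two theta series, then `B_{3,v}(d)` is, modulo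
3, a signed count of pairs of integers. -/
theorem numRegularBipartitions_eq_sum {v : ℕ} (hv : 0 < v) {a b a' b' : ℕ}
    (h : ∀ (R : Type) [CommRing R] (x : R) (N : ℕ), x ^ N = 0 →
      qFactorial x N * qFactorial (x ^ v) N = thetaSum a b N x * thetaSum a' b' N x) (d : ℕ) :
    (numRegularBipartitions 3 v d : ZMod 3) =
      ∑ kl ∈ thetaPairs a b a' b' d, (-1) ^ (kl.1.natAbs + kl.2.natAbs) := by
  have h1 := truncate_regularSeries_three_mul hv (d + 1)
  rw [h _ _ _ (truncate_X_pow (d + 1))] at h1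
  have h2 : thetaSum a b (d + 1) (truncate (d + 1) X) * thetaSum a' b' (d + 1) (truncate (d + 1) X)
      = truncate (d + 1) (thetaSum a b (d + 1) X * thetaSum a' b' (d + 1) X) := by
    simp [thetaSum]
  rw [h2, truncate_eq_iff] at h1
  rw [← coeff_regularSeries_mul, h1 d (Nat.lt_succ_self d), thetaSum, thetaSum,
    Finset.sum_mul_sum, ← Finset.sum_product', map_sum, thetaPairs, Finset.sum_filter]
  refine Finset.sum_congr rfl fun kl _ => ?_
  have : ((-1 : (ZMod 3)⟦X⟧) ^ kl.1.natAbs * X ^ thetaExp a b kl.1) *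
      ((-1) ^ kl.2.natAbs * X ^ thetaExp a' b' kl.2) =
      C ((-1) ^ (kl.1.natAbs + kl.2.natAbs)) * X ^ (thetaExp a b kl.1 + thetaExp a' b' kl.2) := by
    simp only [map_pow, map_neg, map_one]; ring
  rw [this, coeff_C_mul, coeff_X_pow]
  simp [eq_comm]

/-- A coefficient vanishes modulo 3 as soon as its exponent is not represented by the theta
exponents. -/
theorem numRegularBipartitions_modEq_zero {v : ℕ} (hv : 0 < v) {a b a' b' : ℕ}
    (h : ∀ (R : Type) [CommRing R] (x : R) (N : ℕ), x ^ N = 0 →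
      qFactorial x N * qFactorial (x ^ v) N = thetaSum a b N x * thetaSum a' b' N x) {d : ℕ}
    (hd : ∀ k l : ℤ, thetaExp a b k + thetaExp a' b' l ≠ d) :
    numRegularBipartitions 3 v d ≡ 0 [MOD 3] := by
  rw [← ZMod.natCast_eq_natCast_iff, numRegularBipartitions_eq_sum hv h, Nat.cast_zero]
  exact Finset.sum_eq_zero fun kl hkl => absurd (Finset.mem_filter.1 hkl).2 (hd _ _)

end GeneratingFunction

/-! ### Eta products as products of theta series -/

section EtaProducts

variable {R : Type*} [CommRing R]

/-- Euler's pentagonal number theorem for `∏ (1 - x ^ (m i))`. -/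
lemma qFactorial_eq_thetaSum {m N : ℕ} (hm : 1 ≤ m) {x : R} (hx : x ^ N = 0) :
    qFactorial (x ^ m) N = thetaSum m (2 * m) N x := by
  have hq : (x ^ m) ^ N = 0 := by rw [← pow_mul, mul_comm, pow_mul, hx, zero_pow (by omega)]
  rw [← tripleProduct hm (by omega) hx,
    ← qFactorial_eq_of_pow_eq_zero hq (show N ≤ 3 * N by omega)]
  generalize N = L
  induction L with
  | zero => simp [qFactorial]
  | succ L ih =>
    rw [show 3 * (L + 1) = 3 * L + 1 + 1 + 1 by ring, qFactorial_succ, qFactorial_succ,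
      qFactorial_succ, ih]
    simp only [Finset.prod_range_succ]
    ring

lemma qFactorial_mul_qFactorial_five {N : ℕ} {x : R} (hx : x ^ N = 0) :
    qFactorial x N * qFactorial (x ^ 5) N = thetaSum 1 4 N x * thetaSum 2 3 N x := by
  rw [← tripleProduct (by norm_num) (by norm_num) hx, ← tripleProduct (by norm_num) (by norm_num) hx,
    ← qFactorial_eq_of_pow_eq_zero hx (show N ≤ 5 * N by omega)]
  generalize N = L
  induction L with
  | zero => simp [qFactorial]
  | succ L ih =>
    rw [show 5 * (L + 1) = 5 * L + 1 + 1 + 1 + 1 + 1 by ring, qFactorial_succ, qFactorial_succ,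
      qFactorial_succ, qFactorial_succ, qFactorial_succ, qFactorial_succ]
    simp only [Finset.prod_range_succ]
    linear_combination (1 - x ^ (5 * L + 1)) * (1 - x ^ (5 * L + 2)) * (1 - x ^ (5 * L + 3)) *
      (1 - x ^ (5 * L + 4)) * (1 - x ^ (5 * L + 5)) ^ 2 * ih

lemma qFactorial_mul_qFactorial_two {N : ℕ} {x : R} (hx : x ^ N = 0) :
    qFactorial x N * qFactorial (x ^ 2) N = thetaSum 2 2 N x * thetaSum 1 3 N x := by
  have hx2 : (x ^ 2) ^ N = 0 := by rw [← pow_mul, mul_comm, pow_mul, hx, zero_pow (by omega)]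
  rw [← tripleProduct (by norm_num) (by norm_num) hx, ← tripleProduct (by norm_num) (by norm_num) hx,
    ← qFactorial_eq_of_pow_eq_zero hx (show N ≤ 4 * N by omega),
    ← qFactorial_eq_of_pow_eq_zero hx2 (show N ≤ 2 * N by omega)]
  generalize N = L
  induction L with
  | zero => simp [qFactorial]
  | succ L ih =>
    rw [show 4 * (L + 1) = 4 * L + 1 + 1 + 1 + 1 by ring, show 2 * (L + 1) = 2 * L + 1 + 1 by ring,
      qFactorial_succ, qFactorial_succ, qFactorial_succ, qFactorial_succ, qFactorial_succ,
      qFactorial_succ]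
    simp only [Finset.prod_range_succ]
    linear_combination (1 - x ^ (4 * L + 1)) * (1 - x ^ (4 * L + 2)) ^ 2 * (1 - x ^ (4 * L + 3)) *
      (1 - x ^ (4 * L + 4)) ^ 2 * ih

end EtaProducts

/-! ### Binary quadratic forms at inert primes -/

section Inert

/-- If `-D` is not a square modulo `p`, then `p` is inert for the form `a ^ 2 + D * b ^ 2`. -/
lemma dvd_and_dvd_of_not_isSquare {p : ℕ} (hp : p.Prime) {D : ℤ}
    (hD : ¬ IsSquare ((-D : ℤ) : ZMod p)) {a b : ℤ} (h : (p : ℤ) ∣ a ^ 2 + D * b ^ 2) :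
    (p : ℤ) ∣ a ∧ (p : ℤ) ∣ b := by
  have := Fact.mk hp
  rw [← ZMod.intCast_zmod_eq_zero_iff_dvd] at h
  push_cast at h
  have hb : (b : ZMod p) = 0 := by
    by_contra hb
    refine hD ⟨a / b, ?_⟩
    field_simp
    push_cast
    linear_combination -h
  rw [hb] at h
  have ha : (a : ZMod p) = 0 := by simpa using h
  exact ⟨(ZMod.intCast_zmod_eq_zero_iff_dvd _ _).1 ha, (ZMod.intCast_zmod_eq_zero_iff_dvd _ _).1 hb⟩

/-- A form that is anisotropic modulo `p` represents no integer of odd `p`-adic valuation. -/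
lemma ne_of_odd_valuation {p : ℕ} (hp : p.Prime) {D : ℤ}
    (hD : ¬ IsSquare ((-D : ℤ) : ZMod p)) {t : ℤ} (ht : ¬ (p : ℤ) ∣ t) (k : ℕ) (a b : ℤ) :
    a ^ 2 + D * b ^ 2 ≠ (p : ℤ) ^ (2 * k + 1) * t := by
  induction k generalizing a b with
  | zero =>
    intro h
    obtain ⟨⟨c, rfl⟩, ⟨d, rfl⟩⟩ := dvd_and_dvd_of_not_isSquare hp hD
      (h ▸ ⟨t, by ring⟩ : (p : ℤ) ∣ a ^ 2 + D * b ^ 2)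
    have hp0 : (p : ℤ) ≠ 0 := by exact_mod_cast hp.ne_zero
    refine ht ⟨c ^ 2 + D * d ^ 2, mul_left_cancel₀ hp0 ?_⟩
    linear_combination -h
  | succ k ih =>
    intro h
    obtain ⟨⟨c, rfl⟩, ⟨d, rfl⟩⟩ := dvd_and_dvd_of_not_isSquare hp hD
      (h ▸ ⟨(p : ℤ) ^ (2 * k + 2) * t, by ring⟩ : (p : ℤ) ∣ a ^ 2 + D * b ^ 2)
    have hp0 : (p : ℤ) ^ 2 ≠ 0 := by simpa using hp.ne_zero
    refine ih c d (mul_left_cancel₀ hp0 ?_)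
    linear_combination h

/-- The arguments of `B` in the theorem are those `m` for which `c * m + 1` has odd `p`-adic
valuation `2 * k + 1`. -/
lemma exists_mul_add_one_eq {p k n m : ℕ} {j c : ℤ} (hp : p.Prime) (hj : ¬ (p : ℤ) ∣ j)
    (hc : c ∣ (p : ℤ) ^ 2 - 1)
    (hm : (m : ℤ) = (p : ℤ) ^ (2 * k + 2) * n + (p : ℤ) ^ (2 * k + 1) * j
      + ((p : ℤ) ^ (2 * k + 2) - 1) / c) :
    ∃ t : ℤ, ¬ (p : ℤ) ∣ t ∧ c * m + 1 = (p : ℤ) ^ (2 * k + 1) * t := by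
  have hpp : Prime (p : ℤ) := Nat.prime_iff_prime_int.1 hp
  have hdiv : c ∣ (p : ℤ) ^ (2 * k + 2) - 1 := by
    refine hc.trans ?_
    have := sub_dvd_pow_sub_pow ((p : ℤ) ^ 2) 1 (k + 1)
    rwa [one_pow, ← pow_mul, mul_add, mul_one] at this
  have hpc : ¬ (p : ℤ) ∣ c := fun h => hpp.not_dvd_one <| by
    have h1 := h.trans hc
    rwa [dvd_sub_right (dvd_pow_self _ two_ne_zero)] at h1
  refine ⟨p * (c * n + 1) + c * j, fun h => ?_, ?_⟩
  · rw [dvd_add_right (dvd_mul_right _ _)] at h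
    exact (hpp.dvd_or_dvd h).elim hpc hj
  · have := Int.mul_ediv_cancel' hdiv
    rw [hm]
    linear_combination this

end Inert

/-! ### The moduli 5 and 2 -/

theorem numRegularBipartitions_three_five {p m k : ℕ} (hp : p.Prime) (hp4 : p % 4 = 3) {t : ℤ}
    (ht : ¬ (p : ℤ) ∣ t) (hm : 4 * (m : ℤ) + 1 = (p : ℤ) ^ (2 * k + 1) * t) :
    numRegularBipartitions 3 5 m ≡ 0 [MOD 3] := by
  have := Fact.mk hp
  refine numRegularBipartitions_modEq_zero (by norm_num)
    (fun R _ x N hx => qFactorial_mul_qFactorial_five hx) fun a b h => ?_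
  have hD : ¬ IsSquare ((-1 : ℤ) : ZMod p) := by
    rw [Int.cast_neg, Int.cast_one, ZMod.exists_sq_eq_neg_one_iff]
    simpa using hp4
  have h10 : ¬ (p : ℤ) ∣ 10 * t := fun h => by
    rcases (Nat.prime_iff_prime_int.1 hp).dvd_or_dvd h with h | h
    · have h' : p ∣ 2 * 5 := by exact_mod_cast h
      rcases (hp.dvd_mul).1 h' with h | h
      · rw [Nat.prime_dvd_prime_iff_eq hp Nat.prime_two] at h; omega
      · rw [Nat.prime_dvd_prime_iff_eq hp Nat.prime_five] at h; omega
    · exact ht h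
  refine ne_of_odd_valuation hp hD h10 k (10 * a - 3) (10 * b - 1) ?_
  have h1 := two_mul_thetaExp 1 4 a
  have h2 := two_mul_thetaExp 2 3 b
  zify at h
  push_cast at h1 h2
  linear_combination 10 * hm + 40 * h - 20 * h1 - 20 * h2

theorem numRegularBipartitions_three_two {p m k : ℕ} (hp : p.Prime) (hodd : p % 2 = 1)
    (hp8 : p % 8 ≠ 1) {t : ℤ}
    (ht : ¬ (p : ℤ) ∣ t) (hm : 8 * (m : ℤ) + 1 = (p : ℤ) ^ (2 * k + 1) * t) :
    numRegularBipartitions 3 2 m ≡ 0 [MOD 3] := by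
  have := Fact.mk hp
  by_cases hp4 : p % 4 = 3
  -- The form `x ^ 2 + y ^ 2` serves for `p ≡ 3, 7 [MOD 8]`.
  · refine numRegularBipartitions_modEq_zero (by norm_num)
      (fun R _ x N hx => qFactorial_mul_qFactorial_two hx) fun a b h => ?_
    have hD : ¬ IsSquare ((-1 : ℤ) : ZMod p) := by
      rw [Int.cast_neg, Int.cast_one, ZMod.exists_sq_eq_neg_one_iff]
      simpa using hp4
    refine ne_of_odd_valuation hp hD ht k (4 * b - 1) (4 * a) ?_
    have h1 := two_mul_thetaExp 2 2 a
    have h2 := two_mul_thetaExp 1 3 b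
    zify at h
    push_cast at h1 h2
    linear_combination hm + 8 * h - 4 * h1 - 4 * h2
  -- The form `x ^ 2 + 2 * y ^ 2` serves for `p ≡ 5 [MOD 8]`.
  · refine numRegularBipartitions_modEq_zero (a := 1) (b := 2) (a' := 2) (b' := 4) (by norm_num)
      (fun R _ x N hx => ?_) fun a b h => ?_
    · rw [← qFactorial_eq_thetaSum (m := 2) (by norm_num) hx,
        ← qFactorial_eq_thetaSum (m := 1) le_rfl hx, pow_one]
    have hD : ¬ IsSquare ((-2 : ℤ) : ZMod p) := by
      rw [Int.cast_neg, Int.cast_ofNat, ZMod.exists_sq_eq_neg_two_iff (by rintro rfl; omega)]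
      omega
    have h3 : ¬ (p : ℤ) ∣ 3 * t := fun h => by
      rcases (Nat.prime_iff_prime_int.1 hp).dvd_or_dvd h with h | h
      · have h' : p ∣ 3 := by exact_mod_cast h
        rw [Nat.prime_dvd_prime_iff_eq hp Nat.prime_three] at h'; omega
      · exact ht h
    refine ne_of_odd_valuation hp hD h3 k (6 * a - 1) (6 * b - 1) ?_
    have h1 := two_mul_thetaExp 1 2 a
    have h2 := two_mul_thetaExp 2 4 b
    zify at h
    push_cast at h1 h2
    linear_combination 3 * hm + 24 * h - 12 * h1 - 12 * h2

/-! ### The form `x ^ 2 + 7 * y ^ 2` -/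

section NormSeven

/-- Thue's lemma: every residue `r` modulo a prime is a quotient of two integers smaller than
`√p` in absolute value. -/
lemma exists_small_quotient {p : ℕ} (hp : p.Prime) (r : ZMod p) :
    ∃ x y : ℤ, (x ≠ 0 ∨ y ≠ 0) ∧ x ^ 2 < p ∧ y ^ 2 < p ∧ (x : ZMod p) = r * y := by
  have := Fact.mk hp
  set s := Nat.sqrt p with hs
  have hcard : (Finset.univ : Finset (ZMod p)).card <
      (Finset.range (s + 1) ×ˢ Finset.range (s + 1)).card := by
    simpa [ZMod.card] using Nat.lt_succ_sqrt p
  obtain ⟨z, hz, w, hw, hne, heq⟩ := Finset.exists_ne_map_eq_of_card_lt_of_maps_to hcard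
    (f := fun z : ℕ × ℕ => (z.1 : ZMod p) - r * z.2) (fun _ _ => Finset.mem_coe.2 (Finset.mem_univ _))
  simp only [Finset.mem_product, Finset.mem_range] at hz hw
  have hsp : s * s < p := lt_of_le_of_ne (Nat.sqrt_le p) fun h =>
    hp.prime.irreducible.not_isSquare ⟨s, h.symm⟩
  have hbound : ∀ a b : ℕ, a < s + 1 → b < s + 1 → ((a : ℤ) - b) ^ 2 < p := by
    intro a b ha hb
    zify at hsp ha hb
    nlinarith
  refine ⟨z.1 - w.1, z.2 - w.2, ?_, hbound _ _ hz.1 hw.1, hbound _ _ hz.2 hw.2, ?_⟩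
  · by_contra! h
    exact hne (Prod.ext (by omega) (by omega))
  · push_cast
    linear_combination heq

/-- A prime `p ≡ 2 [MOD 3]` modulo which `-7` is a square is represented by `u ^ 2 + 7 * v ^ 2`. -/
lemma exists_eq_sq_add_seven_mul_sq {p : ℕ} (hp : p.Prime) (hp2 : p ≠ 2) (hp3 : p % 3 = 2)
    (hsq : IsSquare ((-7 : ℤ) : ZMod p)) : ∃ u v : ℤ, (p : ℤ) = u ^ 2 + 7 * v ^ 2 := by
  have hpodd : p % 2 = 1 := (Nat.Prime.eq_two_or_odd hp).resolve_left hp2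
  have hp5 : p ≠ 5 := by
    rintro rfl
    revert hsq
    decide
  obtain ⟨r, hr⟩ := hsq
  obtain ⟨x, y, hne, hx, hy, hxy⟩ := exists_small_quotient hp r
  have hdvd : (p : ℤ) ∣ x ^ 2 + 7 * y ^ 2 := by
    rw [← ZMod.intCast_zmod_eq_zero_iff_dvd]
    push_cast at hr ⊢
    rw [hxy]
    linear_combination -(y : ZMod p) ^ 2 * hr
  obtain ⟨k, hk⟩ := hdvd
  have hp0 : (0 : ℤ) < p := by exact_mod_cast hp.pos
  have hpos : 0 < x ^ 2 + 7 * y ^ 2 := by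
    rcases hne with h | h <;> positivity
  have hk0 : 0 < k := by
    rw [hk] at hpos
    exact (pos_iff_pos_of_mul_pos hpos).1 hp0
  have hk8 : k < 8 := by
    by_contra! h
    nlinarith
  -- If a prime `q` in which the form is anisotropic divides `k`, it divides `p`.
  have hinert : ∀ q : ℕ, q.Prime → ¬ IsSquare ((-7 : ℤ) : ZMod q) → (q : ℤ) ∣ k →
      ¬ (q : ℤ) ^ 2 ∣ k → q = p := by
    intro q hq hsq hqk hqk'
    obtain ⟨⟨c, rfl⟩, ⟨d, rfl⟩⟩ := dvd_and_dvd_of_not_isSquare hq hsq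
      (hk ▸ hqk.mul_left _ : (q : ℤ) ∣ x ^ 2 + 7 * y ^ 2)
    by_contra hqp
    have hcop : IsCoprime ((q : ℤ) ^ 2) p :=
      (Nat.isCoprime_iff_coprime.2 ((Nat.coprime_primes hq hp).2 hqp)).pow_left
    exact hqk' (hcop.dvd_of_dvd_mul_left ⟨c ^ 2 + 7 * d ^ 2, by linear_combination -hk⟩)
  have h3 : ¬ IsSquare ((-7 : ℤ) : ZMod 3) := by decide
  have h5 : ¬ IsSquare ((-7 : ℤ) : ZMod 5) := by decide
  have hp3' : p ≠ 3 := by omega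
  -- Two odd squares are congruent to 1 modulo 8.
  have hpar : (k = 2 ∨ k = 4) → x % 2 = 0 ∧ y % 2 = 0 := by
    intro hk'
    rcases Int.even_or_odd' x with ⟨c, rfl | rfl⟩ <;> rcases Int.even_or_odd' y with ⟨d, rfl | rfl⟩
    · omega
    · exfalso
      ring_nf at hk
      rcases hk' with rfl | rfl <;> omega
    · exfalso
      ring_nf at hk
      rcases hk' with rfl | rfl <;> omega
    · exfalso
      have e1 := Int.even_mul_succ_self c
      have e2 := Int.even_mul_succ_self d
      obtain ⟨e, he⟩ := e1
      obtain ⟨f, hf⟩ := e2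
      have : 8 + 8 * e + 56 * f = p * k := by linear_combination hk - 4 * he - 28 * hf
      rcases hk' with rfl | rfl <;> omega
  interval_cases k
  · exact ⟨x, y, by linarith⟩
  · obtain ⟨hx2, hy2⟩ := hpar (Or.inl rfl)
    obtain ⟨c, rfl⟩ := Int.dvd_of_emod_eq_zero hx2
    obtain ⟨d, rfl⟩ := Int.dvd_of_emod_eq_zero hy2
    ring_nf at hk
    omega
  · exact absurd (hinert 3 Nat.prime_three h3 (by norm_num) (by norm_num)).symm hp3'
  · obtain ⟨hx2, hy2⟩ := hpar (Or.inr rfl)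
    obtain ⟨c, rfl⟩ := Int.dvd_of_emod_eq_zero hx2
    obtain ⟨d, rfl⟩ := Int.dvd_of_emod_eq_zero hy2
    exact ⟨c, d, by linarith⟩
  · exact absurd (hinert 5 Nat.prime_five h5 (by norm_num) (by norm_num)).symm hp5
  · exact absurd (hinert 3 Nat.prime_three h3 (by norm_num) (by norm_num)).symm hp3'
  · obtain ⟨c, rfl⟩ : (7 : ℤ) ∣ x := by
      refine (Int.prime_iff_natAbs_prime.2 (by norm_num)).dvd_of_dvd_pow (n := 2) ⟨p - y ^ 2, by linear_combination hk⟩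
    exact ⟨y, c, by linarith⟩

/-- The representations of `m` by `a ^ 2 + 7 * b ^ 2`. -/
noncomputable def normSevenReps (m : ℤ) : Finset (ℤ × ℤ) :=
  (Finset.Icc (-m) m ×ˢ Finset.Icc (-m) m).filter fun z => z.1 ^ 2 + 7 * z.2 ^ 2 = m

lemma mem_normSevenReps {m : ℤ} {z : ℤ × ℤ} :
    z ∈ normSevenReps m ↔ z.1 ^ 2 + 7 * z.2 ^ 2 = m := by
  simp only [normSevenReps, Finset.mem_filter, Finset.mem_product, Finset.mem_Icc,
    and_iff_right_iff_imp]
  intro h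
  have h1 : |z.1| ≤ z.1 ^ 2 := by rw [← sq_abs]; exact Int.le_self_sq _
  have h2 : |z.2| ≤ z.2 ^ 2 := by rw [← sq_abs]; exact Int.le_self_sq _
  rw [← abs_le, ← abs_le]
  constructor <;> nlinarith [sq_nonneg z.1, sq_nonneg z.2]

/-- The sum of `a * b` over the representations of `m` vanishes by the symmetry `b ↦ -b`. -/
lemma sum_mul_normSevenReps (m : ℤ) :
    ∑ z ∈ normSevenReps m, ((z.1 : ZMod 3) * z.2) = 0 := by
  have h : ∑ z ∈ normSevenReps m, ((z.1 : ZMod 3) * z.2) =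
      ∑ z ∈ normSevenReps m, -((z.1 : ZMod 3) * z.2) := by
    refine Finset.sum_nbij' (fun z => (z.1, -z.2)) (fun z => (z.1, -z.2)) ?_ ?_ ?_ ?_ ?_
    · intro z hz; simpa [mem_normSevenReps] using hz
    · intro z hz; simpa [mem_normSevenReps] using hz
    · simp
    · simp
    · simp
  rw [Finset.sum_neg_distrib] at h
  generalize ∑ z ∈ normSevenReps m, ((z.1 : ZMod 3) * z.2) = s at h
  revert h s
  decide

/-- The sum of `a ^ 2 - b ^ 2` over the representations of `m` by `a ^ 2 + 7 * b ^ 2`, in `ZMod 3`.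
It is the `m`-th coefficient of a theta series with the harmonic polynomial `a ^ 2 - 7 * b ^ 2`. -/
noncomputable def normSevenTheta (m : ℤ) : ZMod 3 :=
  ∑ z ∈ normSevenReps m, ((z.1 : ZMod 3) ^ 2 - (z.2 : ZMod 3) ^ 2)

/-- The representations `(a, b)` of `m` such that `a + b * √-7` is divisible by
`u + v * √-7`, an element of norm `p`. -/
noncomputable def divisibleReps (p u v m : ℤ) : Finset (ℤ × ℤ) :=
  (normSevenReps m).filter fun z => p ∣ z.2 * u - z.1 * v

/-- The product of `a + b * √-7` with `u - v * √-7` is `p * (c + d * √-7)`. -/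
lemma exists_of_mem_divisibleReps {p u v n : ℤ} (hp : Prime p) (huv : p = u ^ 2 + 7 * v ^ 2)
    {z : ℤ × ℤ} (hz : z ∈ divisibleReps p u v (p * n)) :
    ∃ c d : ℤ, z.1 * u + 7 * z.2 * v = p * c ∧ z.2 * u - z.1 * v = p * d := by
  obtain ⟨a, b⟩ := z
  simp only [divisibleReps, Finset.mem_filter, mem_normSevenReps] at hz ⊢
  obtain ⟨h, d, hd⟩ := hz
  obtain ⟨c, hc⟩ : p ∣ a * u + 7 * b * v := by
    refine hp.dvd_of_dvd_pow (n := 2) ⟨p * n - 7 * p * d ^ 2, ?_⟩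
    linear_combination (u ^ 2 + 7 * v ^ 2) * h - p * n * huv - 7 * (b * u - a * v + p * d) * hd
  exact ⟨c, d, hc, hd⟩

/-- For `p = u ^ 2 + 7 * v ^ 2 ≡ 2 [MOD 3]`, the multiples of `u + v * √-7` do not contribute: the
summand becomes a multiple of `c * d`. -/
lemma sum_divisibleReps {p u v n : ℤ} (hp : Prime p) (huv : p = u ^ 2 + 7 * v ^ 2)
    (hp3 : p % 3 = 2) :
    ∑ z ∈ divisibleReps p u v (p * n), ((z.1 : ZMod 3) ^ 2 - (z.2 : ZMod 3) ^ 2) = 0 := by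
  have hp0 := hp.ne_zero
  have hmod : (u : ZMod 3) ^ 2 + 7 * (v : ZMod 3) ^ 2 = 2 := by
    have : ((p : ℤ) : ZMod 3) = ((2 : ℤ) : ZMod 3) :=
      (ZMod.intCast_eq_intCast_iff' _ _ _).2 hp3
    rw [huv] at this
    simpa using this
  have halg : ∀ u v c d : ZMod 3, u ^ 2 + 7 * v ^ 2 = 2 →
      (u * c - 7 * v * d) ^ 2 - (u * d + v * c) ^ 2 = -(u * v) * (c * d) := by decide
  rw [← mul_zero (-((u : ZMod 3) * v)), ← sum_mul_normSevenReps n, Finset.mul_sum]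
  symm
  refine Finset.sum_nbij' (fun z => (u * z.1 - 7 * v * z.2, u * z.2 + v * z.1))
    (fun z => ((z.1 * u + 7 * z.2 * v) / p, (z.2 * u - z.1 * v) / p)) ?_ ?_ ?_ ?_ ?_
  · rintro ⟨c, d⟩ h
    simp only [divisibleReps, Finset.mem_filter, mem_normSevenReps] at h ⊢
    refine ⟨?_, d, ?_⟩
    · rw [← h, huv]; ring
    · rw [huv]; ring
  · rintro ⟨a, b⟩ h
    obtain ⟨c, d, hc, hd⟩ := exists_of_mem_divisibleReps hp huv h
    simp only [divisibleReps, Finset.mem_filter, mem_normSevenReps] at h hc hd ⊢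
    obtain ⟨h, -⟩ := h
    rw [hc, hd, Int.mul_ediv_cancel_left _ hp0, Int.mul_ediv_cancel_left _ hp0]
    refine mul_left_cancel₀ (pow_ne_zero 2 hp0) ?_
    linear_combination -(a * u + 7 * b * v + p * c) * hc - 7 * (b * u - a * v + p * d) * hd +
      (u ^ 2 + 7 * v ^ 2) * h - p * n * huv
  · rintro ⟨c, d⟩ -
    have e1 : (u * c - 7 * v * d) * u + 7 * (u * d + v * c) * v = p * c := by rw [huv]; ring
    have e2 : (u * d + v * c) * u - (u * c - 7 * v * d) * v = p * d := by rw [huv]; ring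
    simp only [e1, e2, Int.mul_ediv_cancel_left _ hp0]
  · rintro ⟨a, b⟩ h
    obtain ⟨c, d, hc, hd⟩ := exists_of_mem_divisibleReps hp huv h
    simp only [divisibleReps, Finset.mem_filter, mem_normSevenReps] at h hc hd ⊢
    obtain ⟨h, -⟩ := h
    rw [hc, hd, Int.mul_ediv_cancel_left _ hp0, Int.mul_ediv_cancel_left _ hp0]
    refine Prod.ext (mul_left_cancel₀ hp0 ?_) (mul_left_cancel₀ hp0 ?_)
    · linear_combination -u * hc + 7 * v * hd - a * huv
    · linear_combination -u * hd - v * hc - b * huv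
  · rintro ⟨c, d⟩ -
    push_cast
    exact (halg _ _ _ _ hmod).symm

/-- The Hecke relation at a split prime `p ≡ 2 [MOD 3]`: only the multiples of `p`, which are
divisible by both prime factors `u ± v * √-7`, survive. -/
lemma normSevenTheta_mul_prime {p u v : ℤ} (hp : Prime p) (hp2 : ¬ p ∣ 2) (hp7 : ¬ p ∣ 7)
    (huv : p = u ^ 2 + 7 * v ^ 2) (hp3 : p % 3 = 2) (n : ℤ) :
    normSevenTheta (p * n) + ∑ z ∈ (normSevenReps (p * n)).filter (fun z => p ∣ z.1 ∧ p ∣ z.2),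
      ((z.1 : ZMod 3) ^ 2 - (z.2 : ZMod 3) ^ 2) = 0 := by
  have hboth : ¬ (p ∣ u ∧ p ∣ v) := by
    rintro ⟨⟨c, rfl⟩, ⟨d, rfl⟩⟩
    refine hp.not_dvd_one ⟨c ^ 2 + 7 * d ^ 2, mul_left_cancel₀ hp.ne_zero ?_⟩
    linear_combination huv
  have hv : ¬ p ∣ v := fun h => hboth ⟨hp.dvd_of_dvd_pow (n := 2)
    ((dvd_add_left ((dvd_pow h two_ne_zero).mul_left 7)).1 (dvd_of_eq huv)), h⟩
  have hu : ¬ p ∣ u := fun h => by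
    have h7 : p ∣ 7 * v ^ 2 := (dvd_add_right (dvd_pow h two_ne_zero)).1 (dvd_of_eq huv)
    rcases hp.dvd_or_dvd h7 with h7 | h7
    · exact hp7 h7
    · exact hv (hp.dvd_of_dvd_pow h7)
  have huv' : p = u ^ 2 + 7 * (-v) ^ 2 := by rw [huv]; ring
  have h1 := sum_divisibleReps (n := n) hp huv hp3
  have h2 := sum_divisibleReps (n := n) hp huv' hp3
  have hunion : divisibleReps p u v (p * n) ∪ divisibleReps p u (-v) (p * n) =
      normSevenReps (p * n) := by
    rw [divisibleReps, divisibleReps, ← Finset.filter_or, Finset.filter_eq_self]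
    intro z hz
    rw [mem_normSevenReps] at hz
    refine hp.dvd_or_dvd ⟨z.2 ^ 2 - v ^ 2 * n, ?_⟩
    linear_combination -v ^ 2 * hz - z.2 ^ 2 * huv
  have hinter : divisibleReps p u v (p * n) ∩ divisibleReps p u (-v) (p * n) =
      (normSevenReps (p * n)).filter fun z => p ∣ z.1 ∧ p ∣ z.2 := by
    rw [divisibleReps, divisibleReps, ← Finset.filter_and]
    refine Finset.filter_congr fun z _ => ⟨fun ⟨ha, hb⟩ => ?_, fun ⟨ha, hb⟩ => ?_⟩
    · have e1 : p ∣ 2 * (z.1 * v) := by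
        have := dvd_sub hb ha
        ring_nf at this ⊢
        exact this
      have e2 : p ∣ 2 * (z.2 * u) := by
        have := dvd_add hb ha
        ring_nf at this ⊢
        exact this
      exact ⟨(hp.dvd_or_dvd ((hp.dvd_or_dvd e1).resolve_left hp2)).resolve_right hv,
        (hp.dvd_or_dvd ((hp.dvd_or_dvd e2).resolve_left hp2)).resolve_right hu⟩
    · exact ⟨dvd_sub (hb.mul_right _) (ha.mul_right _), dvd_sub (hb.mul_right _) (ha.mul_right _)⟩
  rw [← hinter, normSevenTheta, ← hunion, Finset.sum_union_inter, h1, h2, add_zero]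

lemma normSevenTheta_eq_zero_of_split {p u v : ℤ} (hp : Prime p) (hp2 : ¬ p ∣ 2) (hp7 : ¬ p ∣ 7)
    (huv : p = u ^ 2 + 7 * v ^ 2) (hp3 : p % 3 = 2) {t : ℤ} (ht : ¬ p ∣ t) (k : ℕ) :
    normSevenTheta (p ^ (2 * k + 1) * t) = 0 := by
  induction k with
  | zero =>
    have h := normSevenTheta_mul_prime hp hp2 hp7 huv hp3 t
    rw [Finset.filter_false_of_mem, Finset.sum_empty, add_zero] at h
    · simpa using h
    · rintro ⟨a, b⟩ hz ⟨⟨c, hc⟩, ⟨d, hd⟩⟩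
      simp only [mem_normSevenReps] at hz hc hd
      subst hc hd
      refine ht ⟨c ^ 2 + 7 * d ^ 2, mul_left_cancel₀ hp.ne_zero ?_⟩
      linear_combination -hz
  | succ k ih =>
    have h := normSevenTheta_mul_prime hp hp2 hp7 huv hp3 (p * (p ^ (2 * k + 1) * t))
    have hp2' : p ^ 2 ≠ 0 := pow_ne_zero 2 hp.ne_zero
    have hpm : ((p : ℤ) : ZMod 3) = ((2 : ℤ) : ZMod 3) :=
      (ZMod.intCast_eq_intCast_iff' _ _ _).2 hp3
    have hs : ∑ z ∈ (normSevenReps (p * (p * (p ^ (2 * k + 1) * t)))).filter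
        (fun z => p ∣ z.1 ∧ p ∣ z.2), ((z.1 : ZMod 3) ^ 2 - (z.2 : ZMod 3) ^ 2) =
        normSevenTheta (p ^ (2 * k + 1) * t) := by
      symm
      refine Finset.sum_nbij' (fun z => (p * z.1, p * z.2)) (fun z => (z.1 / p, z.2 / p))
        ?_ ?_ ?_ ?_ ?_
      · rintro ⟨c, d⟩ hz
        simp only [Finset.mem_filter, mem_normSevenReps] at hz ⊢
        exact ⟨by linear_combination p ^ 2 * hz, dvd_mul_right _ _, dvd_mul_right _ _⟩
      · rintro ⟨a, b⟩ hz
        simp only [Finset.mem_filter, mem_normSevenReps] at hz ⊢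
        obtain ⟨hz, ⟨c, rfl⟩, ⟨d, rfl⟩⟩ := hz
        rw [Int.mul_ediv_cancel_left _ hp.ne_zero, Int.mul_ediv_cancel_left _ hp.ne_zero]
        exact mul_left_cancel₀ hp2' (by linear_combination hz)
      · rintro ⟨c, d⟩ -
        simp [hp.ne_zero]
      · rintro ⟨a, b⟩ hz
        simp only [Finset.mem_filter] at hz
        simp [Int.mul_ediv_cancel' hz.2.1, Int.mul_ediv_cancel' hz.2.2]
      · rintro ⟨c, d⟩ -
        push_cast
        rw [hpm]
        generalize (c : ZMod 3) = c
        generalize (d : ZMod 3) = d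
        revert c d
        decide
    rw [hs, ih, add_zero] at h
    rw [← h]
    congr 1
    ring

/-- The theta series `normSevenTheta` has vanishing coefficients at the integers of odd valuation at
an odd prime `p ≡ 2 [MOD 3]`. -/
theorem normSevenTheta_eq_zero {p : ℕ} (hp : p.Prime) (hp2 : p ≠ 2) (hp3 : p % 3 = 2) {t : ℤ}
    (ht : ¬ (p : ℤ) ∣ t) (k : ℕ) : normSevenTheta ((p : ℤ) ^ (2 * k + 1) * t) = 0 := by
  by_cases hsq : IsSquare ((-7 : ℤ) : ZMod p)
  · obtain ⟨u, v, huv⟩ := exists_eq_sq_add_seven_mul_sq hp hp2 hp3 hsq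
    refine normSevenTheta_eq_zero_of_split (Nat.prime_iff_prime_int.1 hp) (fun h => hp2 ?_)
      (fun h => ?_) huv (by omega) ht k
    · exact (Nat.prime_dvd_prime_iff_eq hp Nat.prime_two).1 (by exact_mod_cast h)
    · have := (Nat.prime_dvd_prime_iff_eq hp (by norm_num : Nat.Prime 7)).1 (by exact_mod_cast h)
      omega
  · refine Finset.sum_eq_zero fun z hz => ?_
    exact absurd (mem_normSevenReps.1 hz) (ne_of_odd_valuation hp hsq ht k _ _)

end NormSeven

/-! ### The modulus 7 -/

section OddReps

/-- The representations of `s` by `x ^ 2 + 7 * y ^ 2` with `x` odd and `x ≡ y [ZMOD 4]`. For `8 ∣ s`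
these are the elements `x + y * √-7` of norm `s` such that `(x + y * √-7) / 2` is divisible by
`(1 + √-7) / 2` and not by `(1 - √-7) / 2`. -/
noncomputable def oddReps (s : ℤ) : Finset (ℤ × ℤ) :=
  (normSevenReps s).filter fun z => z.1 % 2 = 1 ∧ 4 ∣ z.1 - z.2

lemma mem_oddReps {s : ℤ} {z : ℤ × ℤ} :
    z ∈ oddReps s ↔ z.1 ^ 2 + 7 * z.2 ^ 2 = s ∧ z.1 % 2 = 1 ∧ 4 ∣ z.1 - z.2 := by
  simp [oddReps, mem_normSevenReps]

/-- Multiplication by `(1 + √-7) / 2` identifies `oddReps s` with `oddReps (2 * s)`. -/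
lemma sum_oddReps_two_mul {s : ℤ} (hs : 8 ∣ s) (F : ℤ × ℤ → ZMod 3) :
    ∑ z ∈ oddReps (2 * s), F z =
      ∑ z ∈ oddReps s, F ((z.1 - 7 * z.2) / 2, (z.1 + z.2) / 2) := by
  symm
  refine Finset.sum_nbij' (fun z => ((z.1 - 7 * z.2) / 2, (z.1 + z.2) / 2))
    (fun z => ((z.1 + 7 * z.2) / 4, (z.2 - z.1) / 4)) ?_ ?_ ?_ ?_ ?_
  · rintro ⟨x, y⟩ h
    simp only [mem_oddReps] at h ⊢
    obtain ⟨h, hx, t, ht⟩ := h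
    obtain rfl : x = y + 4 * t := by omega
    have e1 : (y + 4 * t - 7 * y) / 2 = -3 * y + 2 * t := by omega
    have e2 : (y + 4 * t + y) / 2 = y + 2 * t := by omega
    rw [e1, e2]
    exact ⟨by linear_combination 2 * h, by omega, by omega⟩
  · rintro ⟨x, y⟩ h
    simp only [mem_oddReps] at h ⊢
    obtain ⟨h, hx, t, ht⟩ := h
    obtain rfl : x = y + 4 * t := by omega
    have e1 : (y + 4 * t + 7 * y) / 4 = 2 * y + t := by omega
    have e2 : (y - (y + 4 * t)) / 4 = -t := by omega
    rw [e1, e2]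
    -- As `16 ∣ 2 * s`, the integer `t` is odd.
    have ht2 : t % 2 = 1 := by
      obtain ⟨r, rfl⟩ := hs
      have hr : y ^ 2 + y * t + 2 * t ^ 2 = 2 * r := by linarith
      obtain ⟨w, hw⟩ : ∃ w, y = 2 * w + 1 := ⟨y / 2, by omega⟩
      rw [hw] at hr
      ring_nf at hr
      omega
    exact ⟨by linarith, by omega, by omega⟩
  · rintro ⟨x, y⟩ h
    simp only [mem_oddReps] at h ⊢
    refine Prod.ext ?_ ?_ <;> simp only <;> omega
  · rintro ⟨x, y⟩ h
    simp only [mem_oddReps] at h ⊢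
    refine Prod.ext ?_ ?_ <;> simp only <;> omega
  · intros; rfl

lemma eight_dvd_of_mem_oddReps {m : ℤ} (hm : m % 2 = 1) {z : ℤ × ℤ} (hz : z ∈ oddReps (8 * m)) :
    8 ∣ z.2 - z.1 := by
  obtain ⟨x, y⟩ := z
  simp only [mem_oddReps] at hz ⊢
  obtain ⟨h, hx, t, ht⟩ := hz
  obtain rfl : x = y + 4 * t := by omega
  have ht2 : t % 2 = 0 := by
    have hr : y ^ 2 + y * t + 2 * t ^ 2 = m := by linarith
    obtain ⟨w, hw⟩ : ∃ w, y = 2 * w + 1 := ⟨y / 2, by omega⟩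
    rw [hw] at hr
    ring_nf at hr
    omega
  omega

/-- Multiplication by `1 + √-7` identifies all representations of an odd `m` with
`oddReps (8 * m)`. -/
lemma sum_oddReps_eight_mul {m : ℤ} (hm : m % 2 = 1) (F : ℤ × ℤ → ZMod 3) :
    ∑ z ∈ oddReps (8 * m), F z =
      ∑ z ∈ normSevenReps m, F (z.1 - 7 * z.2, z.1 + z.2) := by
  symm
  refine Finset.sum_nbij' (fun z => (z.1 - 7 * z.2, z.1 + z.2))
    (fun z => ((z.1 + 7 * z.2) / 8, (z.2 - z.1) / 8)) ?_ ?_ ?_ ?_ ?_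
  · rintro ⟨a, b⟩ h
    simp only [mem_oddReps, mem_normSevenReps] at h ⊢
    refine ⟨by linear_combination 8 * h, ?_, ⟨-2 * b, by ring⟩⟩
    rcases Int.even_or_odd' a with ⟨c, rfl | rfl⟩ <;> rcases Int.even_or_odd' b with ⟨d, rfl | rfl⟩ <;>
      ring_nf at h <;> omega
  · rintro ⟨x, y⟩ h
    obtain ⟨r, hr⟩ := eight_dvd_of_mem_oddReps hm h
    simp only [mem_oddReps, mem_normSevenReps] at h hr ⊢
    obtain ⟨h, -⟩ := h
    obtain rfl : y = x + 8 * r := by omega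
    have e1 : (x + 7 * (x + 8 * r)) / 8 = x + 7 * r := by omega
    have e2 : (x + 8 * r - x) / 8 = r := by omega
    rw [e1, e2]
    linarith
  · rintro ⟨a, b⟩ -
    refine Prod.ext ?_ ?_ <;> simp only <;> omega
  · rintro ⟨x, y⟩ h
    have h8 := eight_dvd_of_mem_oddReps hm h
    refine Prod.ext ?_ ?_ <;> simp only <;> omega
  · intros; rfl

lemma cast_oddReps_halves {s : ℤ} {z : ℤ × ℤ} (hz : z ∈ oddReps s) :
    (2 : ZMod 3) * ((z.1 - 7 * z.2) / 2 : ℤ) = z.1 - 7 * z.2 ∧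
      (2 : ZMod 3) * ((z.1 + z.2) / 2 : ℤ) = z.1 + z.2 := by
  rw [mem_oddReps] at hz
  have e1 : 2 * ((z.1 - 7 * z.2) / 2) = z.1 - 7 * z.2 := by omega
  have e2 : 2 * ((z.1 + z.2) / 2) = z.1 + z.2 := by omega
  exact ⟨by exact_mod_cast congrArg (Int.cast : ℤ → ZMod 3) e1,
    by exact_mod_cast congrArg (Int.cast : ℤ → ZMod 3) e2⟩

lemma sum_mul_oddReps_two_mul {s : ℤ} (hs : 8 ∣ s) :
    ∑ z ∈ oddReps (2 * s), ((z.1 : ZMod 3) * z.2) =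
      ∑ z ∈ oddReps s, ((z.1 : ZMod 3) ^ 2 - (z.2 : ZMod 3) ^ 2) := by
  rw [sum_oddReps_two_mul hs]
  refine Finset.sum_congr rfl fun z hz => ?_
  obtain ⟨h1, h2⟩ := cast_oddReps_halves hz
  have : ∀ A B x y : ZMod 3, 2 * A = x - 7 * y → 2 * B = x + y → A * B = x ^ 2 - y ^ 2 := by decide
  exact this _ _ _ _ h1 h2

lemma sum_sq_sub_sq_oddReps_two_mul {s : ℤ} (hs : 8 ∣ s) :
    ∑ z ∈ oddReps (2 * s), ((z.1 : ZMod 3) ^ 2 - (z.2 : ZMod 3) ^ 2) =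
      -∑ z ∈ oddReps s, ((z.1 : ZMod 3) * z.2) := by
  rw [sum_oddReps_two_mul hs, ← Finset.sum_neg_distrib]
  refine Finset.sum_congr rfl fun z hz => ?_
  obtain ⟨h1, h2⟩ := cast_oddReps_halves hz
  have : ∀ A B x y : ZMod 3, 2 * A = x - 7 * y → 2 * B = x + y → A ^ 2 - B ^ 2 = -(x * y) := by
    decide
  exact this _ _ _ _ h1 h2

/-- The sum of `x * y` over `oddReps (8 * M)` is governed by the odd part of `M`. -/
lemma sum_mul_oddReps_eq_zero {m : ℤ} (hm : m % 2 = 1) (r : ℕ)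
    (h : Odd r ∨ normSevenTheta m = 0) :
    ∑ z ∈ oddReps (8 * (2 ^ r * m)), ((z.1 : ZMod 3) * z.2) = 0 := by
  induction r using Nat.twoStepInduction with
  | zero =>
    have h : normSevenTheta m = 0 := h.resolve_left (by simp)
    rw [pow_zero, one_mul, sum_oddReps_eight_mul hm]
    -- `(a - 7 * b) * (a + b)` is congruent to `a ^ 2 - b ^ 2` modulo 3.
    rw [← h, normSevenTheta]
    refine Finset.sum_congr rfl fun z _ => ?_
    push_cast
    generalize (z.1 : ZMod 3) = x
    generalize (z.2 : ZMod 3) = y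
    revert x y
    decide
  | one =>
    rw [show 8 * (2 ^ 1 * m) = 2 * (8 * m) by ring, sum_mul_oddReps_two_mul (dvd_mul_right _ _),
      sum_oddReps_eight_mul hm, ← neg_zero, ← sum_mul_normSevenReps m, ← Finset.sum_neg_distrib]
    refine Finset.sum_congr rfl fun z _ => ?_
    push_cast
    generalize (z.1 : ZMod 3) = x
    generalize (z.2 : ZMod 3) = y
    revert x y
    decide
  | more r ih _ =>
    have h' : Odd r ∨ normSevenTheta m = 0 := h.imp_left fun h => by
      rw [Nat.odd_iff] at h ⊢; omega
    rw [show 8 * (2 ^ (r + 2) * m) = 2 * (2 * (8 * (2 ^ r * m))) by ring,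
      sum_mul_oddReps_two_mul ((dvd_mul_right _ _).mul_left _),
      sum_sq_sub_sq_oddReps_two_mul (dvd_mul_right _ _), ih h', neg_zero]

lemma intCast_eq_two_of_emod {x : ℤ} (h : x % 3 = 2) : (x : ZMod 3) = 2 := by
  have := (ZMod.intCast_eq_intCast_iff' x 2 3).2 h
  simpa using this

/-- The signed count of pairs of pentagonal numbers is half the sum of `x * y` over `oddReps`, by
`(k, l) ↦ (6 * k - 1, ±(6 * l - 1))`. Half equals `-1` in `ZMod 3`. -/
lemma sum_thetaPairs_eq (d : ℕ) :
    ∑ kl ∈ thetaPairs 1 2 7 14 d, (-1 : ZMod 3) ^ (kl.1.natAbs + kl.2.natAbs) =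
      -∑ z ∈ oddReps (24 * d + 8), ((z.1 : ZMod 3) * z.2) := by
  have hmod : ∀ z ∈ oddReps (24 * d + 8), z.1 % 3 ≠ 0 ∧ z.2 % 3 ≠ 0 := by
    intro z hz
    have h := (mem_oddReps.1 hz).1
    have h3 : (z.1 : ZMod 3) ^ 2 + 7 * (z.2 : ZMod 3) ^ 2 = 2 := by
      rw [← intCast_eq_two_of_emod (x := 24 * d + 8) (by omega), ← h]
      push_cast; rfl
    have hz : ∀ x y : ZMod 3, x ^ 2 + 7 * y ^ 2 = 2 → x ≠ 0 ∧ y ≠ 0 := by decide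
    obtain ⟨h1, h2⟩ := hz _ _ h3
    rw [Ne, ZMod.intCast_zmod_eq_zero_iff_dvd] at h1 h2
    omega
  have hneg : ∑ z ∈ (oddReps (24 * d + 8)).filter (fun z => ¬ z.1 % 3 = 2),
      ((z.1 : ZMod 3) * z.2) =
      ∑ z ∈ (oddReps (24 * d + 8)).filter (fun z => z.1 % 3 = 2), ((z.1 : ZMod 3) * z.2) := by
    refine Finset.sum_nbij' (fun z => (-z.1, -z.2)) (fun z => (-z.1, -z.2)) ?_ ?_ ?_ ?_ ?_
    · intro z hz
      have := hmod z (Finset.mem_filter.1 hz).1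
      simp only [Finset.mem_filter, mem_oddReps, neg_sq] at hz ⊢
      omega
    · intro z hz
      simp only [Finset.mem_filter, mem_oddReps, neg_sq] at hz ⊢
      omega
    · simp
    · simp
    · simp
  rw [← Finset.sum_filter_add_sum_filter_not (oddReps _) (fun z => z.1 % 3 = 2), hneg]
  have hhalf : ∀ s t : ZMod 3, s = t → s = -(t + t) := by decide
  refine hhalf _ _ ?_
  refine Finset.sum_bij
    (fun kl _ => (6 * kl.1 - 1, if (kl.1 + kl.2) % 2 = 0 then 6 * kl.2 - 1 else 1 - 6 * kl.2))
    ?_ ?_ ?_ ?_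
  · rintro ⟨k, l⟩ h
    have h := (Finset.mem_filter.1 h).2
    have h1 := two_mul_thetaExp 1 2 k
    have h2 := two_mul_thetaExp 7 14 l
    zify at h
    push_cast at h1 h2
    simp only [Finset.mem_filter, mem_oddReps]
    have key : (6 * k - 1) ^ 2 + 7 * (6 * l - 1) ^ 2 = 24 * (d : ℤ) + 8 := by
      linear_combination 24 * h - 12 * h1 - 12 * h2
    split_ifs with hkl
    · exact ⟨⟨key, by omega, by omega⟩, by omega⟩
    · exact ⟨⟨by linear_combination key, by omega, by omega⟩, by omega⟩
  · rintro ⟨k, l⟩ - ⟨k', l'⟩ - h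
    simp only [Prod.mk.injEq] at h ⊢
    split_ifs at h <;> omega
  · rintro ⟨x, y⟩ h
    have hy := (hmod _ (Finset.mem_filter.1 h).1).2
    simp only [Finset.mem_filter, mem_oddReps] at h hy
    obtain ⟨⟨h, hx2, hxy⟩, hx3⟩ := h
    obtain ⟨k, rfl⟩ : ∃ k, x = 6 * k - 1 := ⟨(x + 1) / 6, by omega⟩
    have hmem : ∀ l : ℤ, (6 * k - 1) ^ 2 + 7 * (6 * l - 1) ^ 2 = 24 * (d : ℤ) + 8 →
        (k, l) ∈ thetaPairs 1 2 7 14 d := by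
      intro l hl
      have h1 := two_mul_thetaExp 1 2 k
      have h2 := two_mul_thetaExp 7 14 l
      push_cast at h1 h2
      have hsum : thetaExp 1 2 k + thetaExp 7 14 l = d := by
        zify
        linarith
      have b1 := natAbs_le_thetaExp (a := 1) (b := 2) (by norm_num) (by norm_num) k
      have b2 := natAbs_le_thetaExp (a := 7) (b := 14) (by norm_num) (by norm_num) l
      simp only [thetaPairs, Finset.mem_filter, Finset.mem_product, Finset.mem_Icc]
      omega
    rcases (by omega : y % 6 = 5 ∨ y % 6 = 1) with h6 | h6
    · obtain ⟨l, rfl⟩ : ∃ l, y = 6 * l - 1 := ⟨(y + 1) / 6, by omega⟩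
      exact ⟨(k, l), hmem l h, by rw [if_pos (by simp only; omega)]⟩
    · obtain ⟨l, rfl⟩ : ∃ l, y = 1 - 6 * l := ⟨(1 - y) / 6, by omega⟩
      exact ⟨(k, l), hmem l (by linear_combination h), by rw [if_neg (by simp only; omega)]⟩
  · rintro ⟨k, l⟩ -
    have h6 : (6 : ZMod 3) = 0 := rfl
    simp only
    split_ifs with hkl
    · have : Even (k.natAbs + l.natAbs) := by rw [Nat.even_iff]; omega
      rw [this.neg_one_pow]
      push_cast
      rw [h6]; ring
    · have : Odd (k.natAbs + l.natAbs) := by rw [Nat.odd_iff]; omega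
      rw [this.neg_one_pow]
      push_cast
      rw [h6]; ring

theorem numRegularBipartitions_three_seven {p m k : ℕ} (hp : p.Prime) (hp3 : p % 3 = 2) {t : ℤ}
    (ht : ¬ (p : ℤ) ∣ t) (hm : 3 * (m : ℤ) + 1 = (p : ℤ) ^ (2 * k + 1) * t) :
    numRegularBipartitions 3 7 m ≡ 0 [MOD 3] := by
  rw [← ZMod.natCast_eq_natCast_iff, Nat.cast_zero,
    numRegularBipartitions_eq_sum (a := 1) (b := 2) (a' := 7) (b' := 14) (by norm_num)
      fun R _ x N hx => by
        rw [← qFactorial_eq_thetaSum (m := 7) (by norm_num) hx,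
          ← qFactorial_eq_thetaSum (m := 1) le_rfl hx, pow_one],
    sum_thetaPairs_eq, show 24 * (m : ℤ) + 8 = 8 * (3 * m + 1) by ring, hm, neg_eq_zero]
  rcases eq_or_ne p 2 with rfl | hp2
  · exact sum_mul_oddReps_eq_zero (by push_cast at ht; omega) _ (Or.inl ⟨k, rfl⟩)
  · have ht0 : t ≠ 0 := by rintro rfl; simp at ht
    obtain ⟨r, t', ht', rfl⟩ : ∃ (r : ℕ) (t' : ℤ), ¬ 2 ∣ t' ∧ t = 2 ^ r * t' := by
      obtain ⟨t', h1, h2⟩ := (Int.finiteMultiplicity_iff.2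
        ⟨by norm_num, ht0⟩ : FiniteMultiplicity (2 : ℤ) t).exists_eq_pow_mul_and_not_dvd
      exact ⟨_, t', h2, h1⟩
    have hpodd : (p : ℤ) % 2 = 1 := by
      have := (Nat.Prime.eq_two_or_odd hp).resolve_left hp2
      omega
    have hodd : ((p : ℤ) ^ (2 * k + 1) * t') % 2 = 1 := by
      rw [← Int.odd_iff] at hpodd ⊢
      exact hpodd.pow.mul (Int.odd_iff.2 (by omega))
    rw [show (p : ℤ) ^ (2 * k + 1) * (2 ^ r * t') = 2 ^ r * ((p : ℤ) ^ (2 * k + 1) * t') by ring]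
    exact sum_mul_oddReps_eq_zero hodd r
      (Or.inr (normSevenTheta_eq_zero hp hp2 hp3 (fun h => ht (h.mul_left _)) k))

end OddReps

/-! ### The congruences -/

theorem corollary1p3 (k n p : ℕ) (hp : p.Prime) (j : ℤ) (hj : ¬ (p : ℤ) ∣ j) :
    (p ≡ 2 [MOD 3] → ∀ m : ℕ,
      (m : ℤ) = (p : ℤ) ^ (2 * k + 2) * n + (p : ℤ) ^ (2 * k + 1) * j
        + ((p : ℤ) ^ (2 * k + 2) - 1) / 3 →
      numRegularBipartitions 3 7 m ≡ 0 [MOD 3]) ∧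
    (p ≡ 3 [MOD 4] → ∀ m : ℕ,
      (m : ℤ) = (p : ℤ) ^ (2 * k + 2) * n + (p : ℤ) ^ (2 * k + 1) * j
        + ((p : ℤ) ^ (2 * k + 2) - 1) / 4 →
      numRegularBipartitions 3 5 m ≡ 0 [MOD 3]) ∧
    (Odd p → ¬ p ≡ 1 [MOD 8] → ∀ m : ℕ,
      (m : ℤ) = (p : ℤ) ^ (2 * k + 2) * n + (p : ℤ) ^ (2 * k + 1) * j
        + ((p : ℤ) ^ (2 * k + 2) - 1) / 8 →
      numRegularBipartitions 3 2 m ≡ 0 [MOD 3]) := by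
  refine ⟨fun h m hm => ?_, fun h m hm => ?_, fun hodd h m hm => ?_⟩
  · have hp3 : p % 3 = 2 := h
    have hc : (3 : ℤ) ∣ (p : ℤ) ^ 2 - 1 := by
      obtain ⟨r, hr⟩ : ∃ r : ℤ, (p : ℤ) = 3 * r + 2 := ⟨p / 3, by omega⟩
      exact ⟨3 * r ^ 2 + 4 * r + 1, by rw [hr]; ring⟩
    obtain ⟨t, ht, hmt⟩ := exists_mul_add_one_eq hp hj hc hm
    exact numRegularBipartitions_three_seven hp hp3 ht hmt
  · have hp4 : p % 4 = 3 := h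
    have hc : (4 : ℤ) ∣ (p : ℤ) ^ 2 - 1 := by
      obtain ⟨r, hr⟩ : ∃ r : ℤ, (p : ℤ) = 4 * r + 3 := ⟨p / 4, by omega⟩
      exact ⟨4 * r ^ 2 + 6 * r + 2, by rw [hr]; ring⟩
    obtain ⟨t, ht, hmt⟩ := exists_mul_add_one_eq hp hj hc hm
    exact numRegularBipartitions_three_five hp hp4 ht hmt
  · have hc : (8 : ℤ) ∣ (p : ℤ) ^ 2 - 1 :=
      Int.eight_dvd_sq_sub_one_of_odd (by exact_mod_cast hodd)
    obtain ⟨t, ht, hmt⟩ := exists_mul_add_one_eq hp hj hc hm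
    exact numRegularBipartitions_three_two hp (Nat.odd_iff.1 hodd) h ht hmt
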